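/- Assume the Continuum Hypothesis $2^{\aleph_0}=\aleph_1$ and that there is a Suslin line (a linearly ordered set whose order topology satisfies the countable chain condition but is not separable). Then there is an uncountable almost disjoint family $\mathcal A$ of subsets of $\mathbb N$ which is anti-Luzin and has no uncountable subfamily that is a hidden weak tree family. Here: - A family of sets is *almost disjoint* if its members are infinite and any two distinct members have finite intersection. - $\mathcal A$ is *anti-Luzin* if for every $\mathcal B\subseteq\mathcal A$ with $|\mathcal B|=\aleph_1$ there are $\mathcal C,\mathcal D\subseteq\mathcal B$ with $|\mathcal C|=|\mathcal D|=\aleph_1$ such that $\bigcup\mathcal C\cap\bigcup\mathcal D$ is finite. - A *tree ordering* of a set $T$ is a strict partial order on $T$ such that the set of predecessors of each element is well-ordered; a *branch* is a maximal chain. - An uncountable almost disjoint family $\mathcal B$ is a *weak tree family* if there are a tree ordering $\prec$ of $\bigcup\mathcal B$ and a one-to-one function $\varphi$ from $\mathcal B$ to the set of branches of $(\bigcup\mathcal B,\prec)$ such that any two distinct branches in the range of $\varphi$ have finite intersection and $b\setminus\varphi(b)$ is finite for every $b\in\mathcal B$. - A family $\mathcal B$ is a *hidden weak tree family* if for some set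 $T$ the family $\{b\cap T: b\in\mathcal B\}$ is a weak tree family. -/

import Mathlib

open scoped Cardinal

/-- A Suslin line: a linear order whose order topology satisfies the countable chain condition
(every family of pairwise disjoint nonempty open sets is countable) but is not separable. -/
structure IsSuslinLine (L : Type*) [LinearOrder L] [TopologicalSpace L] [OrderTopology L] :
    Prop where
  ccc : ∀ S : Set (Set L), (∀ U ∈ S, IsOpen U ∧ U.Nonempty) →
    S.Pairwise (fun U V => Disjoint U V) → S.Countable
  not_separable : ¬ TopologicalSpace.SeparableSpace L

/-- An almost disjoint family: a collection of infinite sets with finite pairwise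
intersections. -/
def IsAlmostDisjointFamily {W : Type*} (A : Set (Set W)) : Prop :=
  (∀ a ∈ A, a.Infinite) ∧ A.Pairwise (fun a b => (a ∩ b).Finite)

/-- `A` is anti-Luzin: every subfamily of size `ℵ₁` has two subfamilies of size `ℵ₁` whose unions
have finite intersection. -/
def IsAntiLuzin {W : Type*} (A : Set (Set W)) : Prop :=
  ∀ B ⊆ A, #B = ℵ₁ →
    ∃ C ⊆ B, ∃ D ⊆ B, #C = ℵ₁ ∧ #D = ℵ₁ ∧ (⋃₀ C ∩ ⋃₀ D).Finite

/-- `(T, r)` is a (set-theoretic) tree: `r` is a strict partial order on `T` and the set of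
predecessors in `T` of each element of `T` is well-ordered by `r`. Only the restriction of `r` to
`T` matters. -/
structure IsTreeOrder {W : Type*} (T : Set W) (r : W → W → Prop) : Prop where
  irrefl : ∀ x ∈ T, ¬ r x x
  trans : ∀ x ∈ T, ∀ y ∈ T, ∀ z ∈ T, r x y → r y z → r x z
  pred_total : ∀ x ∈ T, ∀ y ∈ T, ∀ z ∈ T, r y x → r z x → r y z ∨ y = z ∨ r z y
  pred_wellFounded : ∀ x ∈ T, {y | y ∈ T ∧ r y x}.WellFoundedOn r

/-- A branch of `(T, r)`: a maximal chain. -/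
def IsTreeBranch {W : Type*} (T : Set W) (r : W → W → Prop) (b : Set W) : Prop :=
  Maximal (fun c : Set W => c ⊆ T ∧ IsChain r c) b

/-- `A` is a weak tree family: an uncountable almost disjoint family for which there are a tree
ordering `r` of `⋃ A` and a one-to-one map `φ` from `A` to the branches of `(⋃ A, r)`, with range
pairwise disjoint (mod finite), such that each `a ∈ A` is contained, mod finite, in `φ a`. -/
def IsWeakTreeFamily {W : Type*} (A : Set (Set W)) : Prop :=
  ¬ A.Countable ∧ IsAlmostDisjointFamily A ∧
    ∃ r : W → W → Prop, IsTreeOrder (⋃₀ A) r ∧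
      ∃ φ : Set W → Set W, (∀ a ∈ A, IsTreeBranch (⋃₀ A) r (φ a)) ∧ Set.InjOn φ A ∧
        (φ '' A).Pairwise (fun b c => (b ∩ c).Finite) ∧ ∀ a ∈ A, (a \ φ a).Finite

/-- `A` is a hidden weak tree family: for some `T`, the traces `a ∩ T`, `a ∈ A`, form a weak tree
family. -/
def IsHiddenWeakTreeFamily {W : Type*} (A : Set (Set W)) : Prop :=
  ∃ T : Set W, IsWeakTreeFamily ((fun a => a ∩ T) '' A)

/-! The construction indexes the family by an uncountable well-ordered type with countable initial
segments, and gets the branching it needs from a coherent sequence of finite-to-one functions, so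
that no property of the Suslin line itself is used.
-/

/-! View functions `W → ℕ`, with `W` of type ω₁, as branches of a tree whose nodes carry infinite
sets of naturals, almost decreasing along branches and almost disjoint at incompatible nodes
(`exists_isTower`). The family consists of the sets `x (e i) i` for a coherent finite-to-one
sequence `e`. Coherence leaves only countably many relevant nodes on each level
(`IsTower.countable_level`).

Finite-to-one functions force every uncountable set of indices to split uncountably at some level
(`IsCoherentSequence.exists_splitting`); this gives the anti-Luzin property.

Under CH the levels enumerate all pairs `(T, r)`, and nodes on the level of a tree order are
homogeneous for it. If an uncountable subfamily were a hidden weak tree family, distinct indices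
above the level of its tree would need distinct nodes there, against countability of the level. -/

section Construction

open Set

variable {W : Type*} [LinearOrder W]

/-! ### Coherent finite-to-one functions -/

/-- A coherent sequence of finite-to-one functions on the initial segments of a well-order. -/
structure IsCoherentSequence (e : W → W → ℕ) : Prop where
  self : ∀ a, e a a = 0
  pos : ∀ a, ∀ b < a, 0 < e a b
  finite_le : ∀ a n, {b | b ≤ a ∧ e a b ≤ n}.Finite
  coherent : ∀ a, ∀ b < a, {c | c ≤ b ∧ e a c ≠ e b c}.Finite

theorem exists_minimizing_between (hW : ∀ w : W, (Iio w).Countable) :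
    ∃ (c : W → W → ℕ) (m : W → W → W), (∀ a, InjOn (c a) (Iio a)) ∧
      ∀ a b, b < a → b ≤ m a b ∧ m a b < a ∧ ∀ d, b ≤ d → d < a → c a (m a b) ≤ c a d := by
  choose c hc using fun w => countable_iff_exists_injOn.1 (hW w)
  have hm : ∀ a b, ∃ m, b < a → b ≤ m ∧ m < a ∧ ∀ d, b ≤ d → d < a → c a m ≤ c a d := by
    intro a b
    by_cases h : b < a
    · obtain ⟨m, hm, hmin⟩ := exists_minimalFor_of_wellFoundedLT (fun d => b ≤ d ∧ d < a) (c a)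
        ⟨b, le_rfl, h⟩
      refine ⟨m, fun _ => ⟨hm.1, hm.2, fun d h1 h2 => ?_⟩⟩
      rcases le_total (c a m) (c a d) with h3 | h3
      · exact h3
      · exact hmin ⟨h1, h2⟩ h3
    · exact ⟨b, fun h' => absurd h' h⟩
  choose m hm using hm
  exact ⟨c, m, hc, hm⟩

theorem exists_isCoherentSequence [WellFoundedLT W] (hW : ∀ w : W, (Iio w).Countable) :
    ∃ e : W → W → ℕ, IsCoherentSequence e := by
  obtain ⟨c, m, hc, hm⟩ := exists_minimizing_between hW
  -- The largest code, plus one, met on the walk from `a` down to `b` with steps `m`; the `+ 1`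
  -- gives positivity below `a`.
  let F : ∀ a : W, (∀ b, b < a → W → ℕ) → W → ℕ := fun a ih b =>
    if h : b < a then max (c a (m a b) + 1) (ih (m a b) (hm a b h).2.1 b) else 0
  let e : W → W → ℕ := (wellFounded_lt (α := W)).fix F
  have he : ∀ a b, e a b = if b < a then max (c a (m a b) + 1) (e (m a b) b) else 0 := by
    intro a b
    have h := congrFun ((wellFounded_lt (α := W)).fix_eq F a) b
    change e a b = F a (fun b _ => e b) b at h
    rw [h]
    by_cases hb : b < a <;> simp [F, hb]
  have hfin : ∀ a n, {d | d < a ∧ c a d ≤ n}.Finite := fun a n =>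
    Finite.of_finite_image ((finite_Iic n).subset (by rintro _ ⟨d, hd, rfl⟩; exact hd.2))
      ((hc a).mono fun d hd => hd.1)
  have hle : ∀ a n, {b | b ≤ a ∧ e a b ≤ n}.Finite := by
    intro a
    induction a using WellFoundedLT.induction with
    | ind a ih =>
      intro n
      refine ((finite_singleton a).union
        ((hfin a n).biUnion fun d hd => ih d hd.1 n)).subset fun b hb => ?_
      rcases hb.1.lt_or_eq with h | h
      · have h2 := hb.2
        rw [he, if_pos h] at h2
        obtain ⟨h3, h4, -⟩ := hm a b h
        exact Or.inr (mem_biUnion (x := m a b) ⟨h4, by omega⟩ ⟨h3, by omega⟩)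
      · exact Or.inl h
  refine ⟨e, fun a => by rw [he, if_neg (lt_irrefl a)], fun a b h => by rw [he, if_pos h]; omega,
    hle, ?_⟩
  intro a
  induction a using WellFoundedLT.induction with
  | ind a ih =>
    intro b hb
    have hpair : ∀ d < a, {x | x ≤ d ∧ x ≤ b ∧ e d x ≠ e b x}.Finite := by
      intro d hd
      rcases lt_trichotomy d b with h | rfl | h
      · exact (ih b hb d h).subset fun x hx => ⟨hx.1, hx.2.2.symm⟩
      · exact finite_empty.subset fun x hx => hx.2.2 rfl
      · exact (ih d hd b h).subset fun x hx => hx.2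
    -- As `b` competes in the minimum, the first step `d` from `a` has code at most `c a b`, so
    -- finitely many `d` occur. For each `d`, outside finitely many `x` the term `e d x` attains the
    -- maximum and induction applies.
    refine ((hfin a (c a b)).biUnion fun d hd =>
      (hle d (c a b + 1)).union (hpair d hd.1)).subset fun x hx => ?_
    obtain ⟨hxb, hne⟩ := hx
    obtain ⟨h3, h4, h5⟩ := hm a x (hxb.trans_lt hb)
    have h6 := h5 b hxb hb
    refine mem_biUnion (x := m a x) ⟨h4, h6⟩ ?_
    rw [he, if_pos (hxb.trans_lt hb)] at hne
    by_cases h7 : e (m a x) x ≤ c a b + 1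
    · exact Or.inl ⟨h3, h7⟩
    · exact Or.inr ⟨h3, hxb, by rwa [max_eq_right (by omega)] at hne⟩

/-! ### Towers of infinite sets -/

/-- A countable family of sets of naturals, all of whose finite subfamilies have an infinite
lower bound modulo finite sets, has an infinite lower bound modulo finite sets. -/
theorem exists_pseudoIntersection {S : Set (Set ℕ)} (hS : S.Countable)
    (hfip : ∀ F ⊆ S, F.Finite → ∃ X : Set ℕ, X.Infinite ∧ ∀ s ∈ F, (X \ s).Finite) :
    ∃ P : Set ℕ, P.Infinite ∧ ∀ s ∈ S, (P \ s).Finite := by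
  rcases S.eq_empty_or_nonempty with rfl | hne
  · exact ⟨univ, infinite_univ, by simp⟩
  obtain ⟨s, rfl⟩ := hS.exists_eq_range hne
  have h : ∀ n, ∃ᶠ k in Filter.atTop, ∀ i ≤ n, k ∈ s i := by
    intro n
    rw [Nat.frequently_atTop_iff_infinite]
    obtain ⟨X, hX, hXs⟩ := hfip (s '' Iic n) (image_subset_range _ _) ((finite_Iic n).image s)
    have h1 : (⋃ i ∈ Iic n, X \ s i).Finite :=
      (finite_Iic n).biUnion fun i hi => hXs _ (mem_image_of_mem s hi)
    refine (hX.sdiff h1).mono fun k hk i hi => ?_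
    by_contra hks
    exact hk.2 (mem_biUnion (x := i) hi ⟨hk.1, hks⟩)
  obtain ⟨φ, hφ, hmem⟩ := Filter.extraction_forall_of_frequently h
  refine ⟨range φ, infinite_range_of_injective hφ.injective, ?_⟩
  rintro _ ⟨i, rfl⟩
  refine ((finite_Iio i).image φ).subset ?_
  rintro _ ⟨⟨n, rfl⟩, hn⟩
  refine ⟨n, ?_, rfl⟩
  by_contra hni
  exact hn (hmem n i (not_lt.1 hni))

theorem exists_infinite_pieces {P : Set ℕ} (hP : P.Infinite) :
    ∃ q : ℕ → Set ℕ, (∀ n, q n ⊆ P ∧ (q n).Infinite) ∧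
      ∀ m n, m ≠ n → Disjoint (q m) (q n) := by
  have : Infinite P := hP.to_subtype
  obtain ⟨g, hg, hgP⟩ : ∃ g : ℕ → ℕ, Function.Injective g ∧ ∀ n, g n ∈ P :=
    ⟨fun n => Infinite.natEmbedding P n,
      Subtype.val_injective.comp (Infinite.natEmbedding P).injective, fun n => Subtype.prop _⟩
  refine ⟨fun n => range fun k => g (Nat.pair n k), fun n => ⟨?_, ?_⟩, fun m n hmn => ?_⟩
  · rintro _ ⟨k, rfl⟩
    exact hgP _
  · exact infinite_range_of_injective fun k l h => (Nat.pair_eq_pair.1 (hg h)).2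
  · rw [Set.disjoint_left]
    rintro _ ⟨k, rfl⟩ ⟨l, h⟩
    exact hmn (Nat.pair_eq_pair.1 (hg h)).1.symm

/-- An almost decreasing assignment of infinite sets to the nodes of the tree of functions from
initial segments of `W` to `ℕ`, with almost disjoint sets at incompatible nodes, and with the
additional property `hom w` at the nodes of level `w`. -/
structure IsTower (hom : W → Set ℕ → Prop) (x : (W → ℕ) → W → Set ℕ) : Prop where
  infinite : ∀ f w, (x f w).Infinite
  hom : ∀ f w, hom w (x f w)
  anti : ∀ f v w, v ≤ w → (x f w \ x f v).Finite
  congr : ∀ f g w, (∀ v ≤ w, f v = g v) → x f w = x g w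
  inter : ∀ f g w, f w ≠ g w → (x f w ∩ x g w).Finite

/-- The countably many earlier sets on a branch have a pseudo-intersection. It is cut into disjoint
infinite pieces, one for each value of `f w`, and each is shrunk to satisfy `hom w`. -/
theorem exists_isTower [WellFoundedLT W] (hW : ∀ w : W, (Iio w).Countable) (hom : W → Set ℕ → Prop)
    (hhom : ∀ w X, X.Infinite → ∃ Y ⊆ X, Y.Infinite ∧ hom w Y) :
    ∃ x, IsTower hom x := by
  have hstep : ∀ (w : W) (S : Set (Set ℕ)), ∃ q : ℕ → Set ℕ, S.Countable →
      (∀ F ⊆ S, F.Finite → ∃ X : Set ℕ, X.Infinite ∧ ∀ s ∈ F, (X \ s).Finite) →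
      (∀ n, (q n).Infinite ∧ hom w (q n) ∧ ∀ s ∈ S, (q n \ s).Finite) ∧
        ∀ m n, m ≠ n → Disjoint (q m) (q n) := by
    intro w S
    by_cases hS : S.Countable ∧
        ∀ F ⊆ S, F.Finite → ∃ X : Set ℕ, X.Infinite ∧ ∀ s ∈ F, (X \ s).Finite
    · obtain ⟨P, hP, hPS⟩ := exists_pseudoIntersection hS.1 hS.2
      obtain ⟨q, hq, hd⟩ := exists_infinite_pieces hP
      choose r hrq hr hrh using fun n => hhom w (q n) (hq n).2
      exact ⟨r, fun _ _ => ⟨fun n => ⟨hr n, hrh n, fun s hs => (hPS s hs).subset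
        (sdiff_subset_sdiff_left ((hrq n).trans (hq n).1))⟩,
        fun m n hmn => (hd m n hmn).mono (hrq m) (hrq n)⟩⟩
    -- Junk value making `q` total; by `key` the recursion never meets it.
    · exact ⟨fun _ => ∅, fun h1 h2 => absurd ⟨h1, h2⟩ hS⟩
  choose q hq using hstep
  let F : (W → ℕ) → ∀ w : W, (∀ v, v < w → Set ℕ) → Set ℕ := fun f w ih =>
    q w (range fun v : Iio w => ih v v.2) (f w)
  let x : (W → ℕ) → W → Set ℕ := fun f => (wellFounded_lt (α := W)).fix (F f)
  have hx : ∀ f w, x f w = q w (x f '' Iio w) (f w) := by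
    intro f w
    have h := (wellFounded_lt (α := W)).fix_eq (F f) w
    change x f w = F f w (fun v _ => x f v) at h
    rw [h, image_eq_range]
  have key : ∀ f w, ((x f w).Infinite ∧ hom w (x f w) ∧ ∀ v < w, (x f w \ x f v).Finite) ∧
      ∀ m n, m ≠ n → Disjoint (q w (x f '' Iio w) m) (q w (x f '' Iio w) n) := by
    intro f w
    induction w using WellFoundedLT.induction with
    | ind w ih =>
      have h := hq w (x f '' Iio w) ((hW w).image _) fun G hG hGf => by
        obtain ⟨V, hV, hVf, rfl⟩ := exists_subset_image_finite_and.1 ⟨G, hG, hGf, rfl⟩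
        rcases V.eq_empty_or_nonempty with rfl | hne
        · exact ⟨univ, infinite_univ, by simp⟩
        obtain ⟨u, hu, hmax⟩ := hVf.exists_maximal hne
        refine ⟨x f u, (ih u (hV hu)).1.1, ?_⟩
        rintro _ ⟨v, hv, rfl⟩
        rcases lt_or_ge v u with h | h
        · exact (ih u (hV hu)).1.2.2 v h
        · rw [le_antisymm (hmax hv h) h, sdiff_self]
          exact finite_empty
      refine ⟨?_, h.2⟩
      rw [hx]
      exact ⟨(h.1 _).1, (h.1 _).2.1, fun v hv => (h.1 _).2.2 _ (mem_image_of_mem _ hv)⟩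
  have hanti : ∀ f v w, v ≤ w → (x f w \ x f v).Finite := by
    intro f v w h
    rcases h.lt_or_eq with h | rfl
    · exact (key f w).1.2.2 v h
    · simp
  have hbelow : ∀ f g w, (∀ v < w, f v = g v) → x f '' Iio w = x g '' Iio w := by
    intro f g w
    induction w using WellFoundedLT.induction with
    | ind w ih =>
      intro h
      refine image_congr fun v hv => ?_
      rw [hx f v, hx g v, ih v hv fun u hu => h u (hu.trans hv), h v hv]
  refine ⟨x, fun f w => (key f w).1.1, fun f w => (key f w).1.2.1, hanti, fun f g w h => ?_,
    fun f g w h => ?_⟩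
  · rw [hx f w, hx g w, hbelow f g w fun v hv => h v hv.le, h w le_rfl]
  -- At their first difference the two branches have the same past, so they choose disjoint pieces.
  · obtain ⟨v, hv, hmin⟩ := exists_minimal_le_of_wellFoundedLT (fun v => f v ≠ g v) w h
    have hd : Disjoint (x f v) (x g v) := by
      rw [hx f v, hx g v, ← hbelow f g v fun u hu => by_contra fun hne =>
        (hmin.2 hne hu.le).not_gt hu]
      exact (key f v).2 _ _ hmin.1
    refine ((hanti f v w hv).union (hanti g v w hv)).subset fun k hk => ?_
    by_cases h1 : k ∈ x f v
    · exact Or.inr ⟨hk.2, Set.disjoint_left.1 hd h1⟩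
    · exact Or.inl ⟨hk.1, h1⟩

/-! ### Almost disjointness and the anti-Luzin property -/

section Family

variable {e : W → W → ℕ} {hom : W → Set ℕ → Prop} {x : (W → ℕ) → W → Set ℕ}

theorem IsTower.inter_finite_of_lt (hx : IsTower hom x) (he : IsCoherentSequence e) {i j : W}
    (hij : i < j) : (x (e i) i ∩ x (e j) j).Finite := by
  have h1 : (x (e i) i ∩ x (e j) i).Finite :=
    hx.inter _ _ _ (by rw [he.self]; exact (he.pos j i hij).ne)
  refine (h1.union (hx.anti (e j) i j hij.le)).subset fun k hk => ?_
  by_cases h : k ∈ x (e j) i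
  · exact Or.inl ⟨hk.1, h⟩
  · exact Or.inr ⟨hk.2, h⟩

theorem IsTower.inter_finite_of_ne (hx : IsTower hom x) (he : IsCoherentSequence e) {i j : W}
    (hij : i ≠ j) : (x (e i) i ∩ x (e j) j).Finite := by
  rcases hij.lt_or_gt with h | h
  · exact hx.inter_finite_of_lt he h
  · rw [inter_comm]
    exact hx.inter_finite_of_lt he h

theorem IsTower.injective (hx : IsTower hom x) (he : IsCoherentSequence e) :
    Function.Injective fun i => x (e i) i := by
  intro i j (hij : x (e i) i = x (e j) j)
  by_contra hne
  have h := hx.inter_finite_of_ne he hne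
  rw [← hij, inter_self] at h
  exact hx.infinite _ _ h

theorem IsTower.isAlmostDisjointFamily_range (hx : IsTower hom x) (he : IsCoherentSequence e) :
    IsAlmostDisjointFamily (range fun i => x (e i) i) := by
  constructor
  · rintro _ ⟨i, rfl⟩
    exact hx.infinite _ _
  · rintro _ ⟨i, rfl⟩ _ ⟨j, rfl⟩ hij
    exact hx.inter_finite_of_ne he fun h => hij (by rw [h])

/-- For `w ≤ i`, `e i` is a finite change of `e w` on the countable set `Iic w`; a finitely
supported integer function records it. -/
theorem IsTower.countable_level (hW : ∀ w : W, (Iio w).Countable) (hx : IsTower hom x)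
    (he : IsCoherentSequence e) (w : W) : ((fun i => x (e i) w) '' Ici w).Countable := by
  have hc : Countable (Iic w) := by
    rw [← Iio_insert]
    exact ((hW w).insert w).to_subtype
  refine (countable_range fun d : Iic w →₀ ℤ =>
    x (fun v => if h : v ≤ w then ((e w v : ℤ) + d ⟨v, h⟩).toNat else 0) w).mono ?_
  rintro _ ⟨i, hi, rfl⟩
  have hfin : {v | v ≤ w ∧ e i v ≠ e w v}.Finite := by
    rcases (mem_Ici.1 hi).lt_or_eq with h | rfl
    · exact he.coherent i w h
    · simp
  have hsupp : (Function.support fun v : Iic w => (e i v : ℤ) - e w v).Finite := by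
    refine Finite.of_finite_image (f := Subtype.val) (hfin.subset ?_) Subtype.val_injective.injOn
    rintro _ ⟨v, hv, rfl⟩
    refine ⟨v.2, fun h => hv ?_⟩
    simp [h]
  refine ⟨Finsupp.ofSupportFinite _ hsupp, hx.congr _ _ _ fun v hv => ?_⟩
  have h : (Finsupp.ofSupportFinite _ hsupp) ⟨v, hv⟩ = (e i v : ℤ) - e w v := rfl
  simp only [hv, dite_true, h]
  omega

/-- Removing a countable set and partitioning into countably many pieces leaves an uncountable
piece. -/
theorem exists_uncountable_fiber {α β : Type*} {J : Set α} (hJ : ¬ J.Countable) (g : α → β)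
    (hg : (g '' J).Countable) : ∃ y, ¬ {k | k ∈ J ∧ g k = y}.Countable := by
  by_contra! h
  exact hJ ((hg.biUnion fun y _ => h y).mono fun k hk =>
    mem_biUnion (x := g k) (mem_image_of_mem g hk)
      (show k ∈ {l | l ∈ J ∧ g l = g k} from ⟨hk, rfl⟩))

/-- Otherwise, at each level `w`, all but countably many `k ∈ J` take one value `f w`. Some `n` is
`f w` for infinitely many `w`, and a single `k` follows `f` at infinitely many of these, so `e k` is
not finite-to-one. -/
theorem IsCoherentSequence.exists_splitting [Uncountable W] (hW : ∀ w : W, (Iio w).Countable)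
    (he : IsCoherentSequence e) {J : Set W} (hJ : ¬ J.Countable) :
    ∃ w m n, m ≠ n ∧ ¬ {k | k ∈ J ∩ Ici w ∧ e k w = m}.Countable ∧
      ¬ {k | k ∈ J ∩ Ici w ∧ e k w = n}.Countable := by
  by_contra! hcon
  have hJw : ∀ w, ¬ (J ∩ Ici w).Countable := fun w h =>
    hJ ((h.union (hW w)).mono fun k hk => (lt_or_ge k w).elim Or.inr fun h => Or.inl ⟨hk, h⟩)
  choose f hf using fun w => exists_uncountable_fiber (hJw w) (fun k => e k w) (to_countable _)
  have hsmall : ∀ w, {k | k ∈ J ∧ ¬ (w ≤ k ∧ e k w = f w)}.Countable := by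
    intro w
    refine ((hW w).union (countable_iUnion fun n : ℕ => countable_iUnion fun h : f w ≠ n =>
      hcon w (f w) n h (hf w))).mono fun k hk => ?_
    rcases lt_or_ge k w with h | h
    · exact Or.inl h
    · exact Or.inr (mem_iUnion₂.2 ⟨e k w, fun h' => hk.2 ⟨h, h'.symm⟩, ⟨hk.1, h⟩, rfl⟩)
  obtain ⟨n, hn⟩ := exists_uncountable_fiber (J := univ) not_countable_univ f (to_countable _)
  have hinf : {w | w ∈ univ ∧ f w = n}.Infinite := fun h => hn h.countable
  obtain ⟨Q, hQ, hQinf⟩ : ∃ g : ℕ → W, (∀ k, f (g k) = n) ∧ Function.Injective g :=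
    ⟨fun k => hinf.natEmbedding _ k, fun k => (hinf.natEmbedding _ k).2.2,
      Subtype.val_injective.comp (hinf.natEmbedding _).injective⟩
  obtain ⟨k, hkJ, hk⟩ : ∃ k ∈ J, ∀ l, Q l ≤ k ∧ e k (Q l) = f (Q l) := by
    by_contra! h
    refine hJ ((countable_iUnion fun l => hsmall (Q l)).mono fun k hk => ?_)
    obtain ⟨l, hl⟩ := h k hk
    exact mem_iUnion.2 ⟨l, hk, fun h' => hl h'.1 h'.2⟩
  refine infinite_range_of_injective hQinf ((he.finite_le k n).subset ?_)
  rintro _ ⟨l, rfl⟩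
  exact ⟨(hk l).1, by rw [(hk l).2, hQ]⟩

theorem countable_iff_mk_lt_aleph_one {α : Type*} {s : Set α} : s.Countable ↔ #s < ℵ₁ := by
  rw [← Cardinal.le_aleph0_iff_set_countable, ← not_lt, ← Cardinal.aleph_one_le_iff, not_le]

theorem mk_eq_aleph_one_of_subset {α : Type*} {B C : Set α} (hB : #B = ℵ₁) (hCB : C ⊆ B)
    (hC : ¬ C.Countable) : #C = ℵ₁ :=
  ((Cardinal.mk_le_mk_of_subset hCB).trans_eq hB).antisymm
    (not_lt.1 fun h => hC (countable_iff_mk_lt_aleph_one.2 h))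

theorem IsTower.isAntiLuzin_range [Uncountable W] (hW : ∀ w : W, (Iio w).Countable)
    (hx : IsTower hom x) (he : IsCoherentSequence e) :
    IsAntiLuzin (range fun i => x (e i) i) := by
  intro B hB hcard
  set a : W → Set ℕ := fun i => x (e i) i with ha
  have hainj : Function.Injective a := hx.injective he
  have hJ : ¬ (a ⁻¹' B).Countable := fun h => by
    have h1 := h.image a
    rw [image_preimage_eq_of_subset hB, countable_iff_mk_lt_aleph_one, hcard] at h1
    exact lt_irrefl _ h1
  obtain ⟨w, m, n, hmn, hm, hn⟩ := he.exists_splitting hW hJ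
  have hcone : ∀ m, ¬ {k | k ∈ a ⁻¹' B ∩ Ici w ∧ e k w = m}.Countable →
      ∃ (i : W) (F : Set ℕ), e i w = m ∧ F.Finite ∧
        ∃ C ⊆ B, ¬ C.Countable ∧ ⋃₀ C ⊆ x (e i) w ∪ F := by
    intro m hm
    -- There are countably many nodes and countably many finite errors; both get fixed on an
    -- uncountable set.
    obtain ⟨X, hX⟩ := exists_uncountable_fiber hm (fun k => x (e k) w)
      ((hx.countable_level hW he w).mono (image_mono fun k hk => hk.1.2))
    obtain ⟨F, hF⟩ := exists_uncountable_fiber hX (fun k => a k \ x (e k) w)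
      (Countable.mono (by
        rintro _ ⟨k, hk, rfl⟩
        exact hx.anti (e k) w k hk.1.1.2) Countable.ofPred_finite)
    obtain ⟨i, ⟨⟨hi, him⟩, hiX⟩, hiF⟩ : {k | k ∈ {k | k ∈ {k | k ∈ a ⁻¹' B ∩ Ici w ∧ e k w = m} ∧
        x (e k) w = X} ∧ a k \ x (e k) w = F}.Nonempty :=
      nonempty_iff_ne_empty.2 fun h => hF (by rw [h]; exact countable_empty)
    refine ⟨i, F, him, hiF ▸ hx.anti (e i) w i hi.2, _, ?_,
      fun h => hF ((mapsTo_image a _).countable_of_injOn hainj.injOn h), ?_⟩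
    · rintro _ ⟨k, hk, rfl⟩
      exact hk.1.1.1.1
    · refine sUnion_subset ?_
      rintro _ ⟨k, ⟨⟨-, hkX⟩, hkF⟩, rfl⟩ y hy
      by_cases h : y ∈ x (e k) w
      · exact Or.inl (by rwa [hiX, ← hkX])
      · exact Or.inr (hkF ▸ ⟨hy, h⟩)
  obtain ⟨i, F, him, hF, C, hCB, hC, hCs⟩ := hcone m hm
  obtain ⟨j, G, hjn, hG, D, hDB, hD, hDs⟩ := hcone n hn
  refine ⟨C, hCB, D, hDB, mk_eq_aleph_one_of_subset hcard hCB hC,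
    mk_eq_aleph_one_of_subset hcard hDB hD, ?_⟩
  have hfin : (x (e i) w ∩ x (e j) w).Finite := hx.inter _ _ _ (by rw [him, hjn]; exact hmn)
  refine ((hfin.union hF).union hG).subset fun y hy => ?_
  rcases hCs hy.1 with h1 | h1
  · rcases hDs hy.2 with h2 | h2
    · exact Or.inl (Or.inl ⟨h1, h2⟩)
    · exact Or.inr h2
  · exact Or.inl (Or.inr h1)

end Family

/-! ### Homogeneous sets and weak tree families -/

/-- Every member of `X` lies outside `T`, or `X` is a chain or an antichain in `T`. -/
def IsHomogeneousFor (T : Set ℕ) (r : ℕ → ℕ → Prop) (X : Set ℕ) : Prop :=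
  Disjoint X T ∨ X ⊆ T ∧ (IsChain r X ∨ IsAntichain r X)

/-- Ramsey's theorem for `r` on `T`, then for its converse; if neither gives a chain, an antichain
remains. -/
theorem IsTreeOrder.exists_isHomogeneousFor {T : Set ℕ} {r : ℕ → ℕ → Prop} (hT : IsTreeOrder T r)
    {X : Set ℕ} (hX : X.Infinite) : ∃ Y ⊆ X, Y.Infinite ∧ IsHomogeneousFor T r Y := by
  by_cases hXT : (X ∩ T).Infinite
  swap
  · refine ⟨X \ T, sdiff_subset, fun h => hX ?_, Or.inl disjoint_sdiff_left⟩
    rw [← inter_union_sdiff X T]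
    exact (not_infinite.1 hXT).union h
  let f : ℕ → ℕ := fun n => hXT.natEmbedding _ n
  have hf : Function.Injective f := Subtype.val_injective.comp (hXT.natEmbedding _).injective
  have hfm : ∀ n, f n ∈ X ∩ T := fun n => (hXT.natEmbedding _ n).2
  let s : ℕ → ℕ → Prop := fun y z => y ∈ T ∧ z ∈ T ∧ r y z
  have hs : IsTrans ℕ s :=
    ⟨fun a b c h1 h2 => ⟨h1.1, h2.2.1, hT.trans a h1.1 b h1.2.1 c h2.2.1 h1.2.2 h2.2.2⟩⟩
  have hs' : IsTrans ℕ (Function.swap s) := ⟨fun a b c h1 h2 => hs.trans c b a h2 h1⟩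
  suffices ∃ g : ℕ ↪o ℕ, IsChain r (range (f ∘ g)) ∨ IsAntichain r (range (f ∘ g)) by
    obtain ⟨g, hg⟩ := this
    exact ⟨range (f ∘ g), by rintro _ ⟨n, rfl⟩; exact (hfm _).1,
      infinite_range_of_injective (hf.comp g.injective),
      Or.inr ⟨by rintro _ ⟨n, rfl⟩; exact (hfm _).2, hg⟩⟩
  obtain ⟨g, hg | hg⟩ := exists_increasing_or_nonincreasing_subseq s f
  · refine ⟨g, Or.inl ?_⟩
    rintro _ ⟨m, rfl⟩ _ ⟨n, rfl⟩ hmn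
    rcases lt_trichotomy m n with h | rfl | h
    · exact Or.inl (hg m n h).2.2
    · exact absurd rfl hmn
    · exact Or.inr (hg n m h).2.2
  obtain ⟨g', hg' | hg'⟩ := exists_increasing_or_nonincreasing_subseq (Function.swap s) (f ∘ g)
  · refine ⟨g'.trans g, Or.inl ?_⟩
    rintro _ ⟨m, rfl⟩ _ ⟨n, rfl⟩ hmn
    rcases lt_trichotomy m n with h | rfl | h
    · exact Or.inr (hg' m n h).2.2
    · exact absurd rfl hmn
    · exact Or.inl (hg' n m h).2.2
  · refine ⟨g'.trans g, Or.inr ?_⟩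
    rintro _ ⟨m, rfl⟩ _ ⟨n, rfl⟩ hmn hr
    rcases lt_trichotomy m n with h | rfl | h
    · exact hg _ _ (g'.lt_iff_lt.2 h) ⟨(hfm _).2, (hfm _).2, hr⟩
    · exact absurd rfl hmn
    · exact hg' n m h ⟨(hfm _).2, (hfm _).2, hr⟩

/-- A predecessor of `y` is comparable with the whole branch, so maximality absorbs it. -/
theorem IsTreeBranch.mem_of_rel {T : Set ℕ} {r : ℕ → ℕ → Prop} (hT : IsTreeOrder T r)
    {b : Set ℕ} (hb : IsTreeBranch T r b) {y z : ℕ} (hy : y ∈ b) (hz : z ∈ T) (h : r z y) :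
    z ∈ b := by
  have hyT := hb.1.1 hy
  refine hb.2 (y := insert z b) ⟨insert_subset hz hb.1.1, hb.1.2.insert fun v hv hzv => ?_⟩
    (subset_insert z b) (mem_insert z b)
  have hvT := hb.1.1 hv
  by_cases hvy : v = y
  · exact Or.inl (hvy ▸ h)
  rcases hb.1.2 hv hy hvy with h1 | h1
  · rcases hT.pred_total y hyT z hz v hvT h h1 with h2 | h2 | h2
    · exact Or.inl h2
    · exact absurd h2 hzv
    · exact Or.inr h2
  · exact Or.inl (hT.trans z hz y hyT v hvT h h1)

/-- Two branches which both meet a chain of the tree in an infinite set have infinite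
intersection. -/
theorem IsTreeBranch.inter_infinite {T : Set ℕ} {r : ℕ → ℕ → Prop} (hT : IsTreeOrder T r)
    {b c X : Set ℕ} (hb : IsTreeBranch T r b) (hc : IsTreeBranch T r c) (hXT : X ⊆ T)
    (hX : IsChain r X) (hbX : (b ∩ X).Infinite) (hcX : (c ∩ X).Infinite) :
    (b ∩ c).Infinite := by
  by_cases h : ∃ y ∈ b ∩ X, y ∉ c
  · obtain ⟨y, hy, hyc⟩ := h
    refine hcX.mono fun z hz => ⟨?_, hz.1⟩
    have hne : z ≠ y := fun h => hyc (h ▸ hz.1)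
    rcases hX hz.2 hy.2 hne with h1 | h1
    · exact hb.mem_of_rel hT hy.1 (hXT hz.2) h1
    · exact absurd (hc.mem_of_rel hT hz.1 (hXT hy.2) h1) hyc
  · push Not at h
    exact hbX.mono fun y hy => ⟨hy.1, h y hy⟩

theorem IsTower.not_isHiddenWeakTreeFamily {e : W → W → ℕ} {x : (W → ℕ) → W → Set ℕ}
    {req : W → Set ℕ × (ℕ → ℕ → Prop)} (hreq : Function.Surjective req)
    (hW : ∀ w : W, (Iio w).Countable) (he : IsCoherentSequence e)
    (hx : IsTower (fun w X => IsTreeOrder (req w).1 (req w).2 →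
      IsHomogeneousFor (req w).1 (req w).2 X) x)
    {B : Set (Set ℕ)} (hB : B ⊆ range fun i => x (e i) i) (hBc : ¬ B.Countable) :
    ¬ IsHiddenWeakTreeFamily B := by
  rintro ⟨T, -, hAD, r, hr, φ, hφb, hφi, hφd, hφs⟩
  set T' := ⋃₀ ((fun a => a ∩ T) '' B) with hT'
  obtain ⟨w, hw⟩ := hreq (T', r)
  set a : W → Set ℕ := fun i => x (e i) i with ha
  have hhom : ∀ f, IsHomogeneousFor T' r (x f w) := fun f => by
    have h := hx.hom f w
    rw [hw] at h
    exact h hr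
  have htrace : ∀ i ∈ a ⁻¹' B, a i ∩ T ∈ (fun a => a ∩ T) '' B := fun i hi =>
    mem_image_of_mem _ hi
  have hinf : ∀ i ∈ a ⁻¹' B ∩ Ici w, (φ (a i ∩ T) ∩ (x (e i) w ∩ T')).Infinite := by
    intro i hi hfin
    have h1 := hφs _ (htrace i hi.1)
    have h2 := hx.anti (e i) w i hi.2
    refine hAD.1 _ (htrace i hi.1) (((h1.union h2).union hfin).subset fun y hy => ?_)
    by_cases hy1 : y ∈ φ (a i ∩ T)
    · by_cases hy2 : y ∈ x (e i) w
      · exact Or.inr ⟨hy1, hy2, mem_sUnion_of_mem hy (htrace i hi.1)⟩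
      · exact Or.inl (Or.inr ⟨hy.1, hy2⟩)
    · exact Or.inl (Or.inl ⟨hy, hy1⟩)
  -- By `hinf` a node meets a branch infinitely often, so it must be a chain. Indices sharing it
  -- have branches with infinite intersection, hence equal branches and equal traces, against almost
  -- disjointness.
  have hinj : InjOn (fun i => x (e i) w) (a ⁻¹' B ∩ Ici w) := by
    intro i hi j hj (hij : x (e i) w = x (e j) w)
    have hi1 := hinf i hi
    have hj1 := hinf j hj
    rw [← hij] at hj1
    have hbi := hφb _ (htrace i hi.1)
    have hbj := hφb _ (htrace j hj.1)
    rcases hhom (e i) with h | ⟨hsub, h | h⟩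
    · rw [h.inter_eq, inter_empty] at hi1
      exact absurd finite_empty hi1
    · rw [inter_eq_left.2 hsub] at hi1 hj1
      have h1 := IsTreeBranch.inter_infinite hr hbi hbj hsub h hi1 hj1
      have h2 : φ (a i ∩ T) = φ (a j ∩ T) := by
        by_contra hne
        exact h1 (hφd (mem_image_of_mem φ (htrace i hi.1)) (mem_image_of_mem φ (htrace j hj.1)) hne)
      have h3 := hφi (htrace i hi.1) (htrace j hj.1) h2
      by_contra hne
      refine hAD.1 _ (htrace i hi.1) ((hx.inter_finite_of_ne he hne).subset fun y hy => ?_)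
      exact ⟨hy.1, (h3 ▸ hy).1⟩
    · rw [inter_eq_left.2 hsub] at hi1
      obtain ⟨y, hy, z, hz, hyz⟩ := hi1.nontrivial
      rcases hbi.1.2 hy.1 hz.1 hyz with h1 | h1
      · exact absurd h1 (h hy.2 hz.2 hyz)
      · exact absurd h1 (h hz.2 hy.2 hyz.symm)
  have hJ : (a ⁻¹' B ∩ Ici w).Countable := (mapsTo_image _ _).countable_of_injOn hinj
    ((hx.countable_level hW he w).mono (image_mono inter_subset_right))
  refine hBc ?_
  rw [← image_preimage_eq_of_subset hB]
  exact ((hJ.union (hW w)).mono fun k hk => (lt_or_ge k w).elim Or.inr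
    fun h => Or.inl ⟨hk, h⟩).image a

end Construction

theorem theorem4p6 (CH : (𝔠 : Cardinal.{0}) = ℵ₁)
    {L : Type*} [LinearOrder L] [TopologicalSpace L] [OrderTopology L] (hL : IsSuslinLine L) :
    ∃ A : Set (Set ℕ), ¬ A.Countable ∧ IsAlmostDisjointFamily A ∧ IsAntiLuzin A ∧
      ∀ B ⊆ A, ¬ B.Countable → ¬ IsHiddenWeakTreeFamily B := by
  let W := (ℵ₁ : Cardinal.{0}).ord.ToType
  have hcard : #W = ℵ₁ := Cardinal.mk_ord_toType _
  have hW : ∀ w : W, (Set.Iio w).Countable := fun w =>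
    countable_iff_mk_lt_aleph_one.2
      ((Cardinal.mk_Iio_lt w (by rw [hcard]; simp [W])).trans_eq hcard)
  have : Uncountable W := by
    rw [← Cardinal.aleph0_lt_mk_iff, hcard]
    exact Cardinal.aleph0_lt_aleph_one
  -- By CH there are exactly ℵ₁ pairs, so each gets a level.
  obtain ⟨req⟩ : Nonempty (W ≃ Set ℕ × (ℕ → ℕ → Prop)) := by
    rw [← Cardinal.eq, hcard, ← CH]
    simp [Cardinal.mk_set]
  obtain ⟨e, he⟩ := exists_isCoherentSequence hW
  obtain ⟨x, hx⟩ := exists_isTower hW (fun w X => IsTreeOrder (req w).1 (req w).2 →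
      IsHomogeneousFor (req w).1 (req w).2 X) fun w X hX => by
    by_cases hT : IsTreeOrder (req w).1 (req w).2
    · obtain ⟨Y, hYX, hY, hh⟩ := hT.exists_isHomogeneousFor hX
      exact ⟨Y, hYX, hY, fun _ => hh⟩
    · exact ⟨X, subset_rfl, hX, fun h => absurd h hT⟩
  refine ⟨Set.range fun i => x (e i) i, fun h => ?_, hx.isAlmostDisjointFamily_range he,
    hx.isAntiLuzin_range hW he, fun B hB hBc =>
    hx.not_isHiddenWeakTreeFamily req.surjective hW he hB hBc⟩
  exact Set.not_countable_univ
    ((Set.mapsTo_range _ Set.univ).countable_of_injOn (hx.injective he).injOn h)
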